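/- Let $V$ be a finite set of points, each of which has exactly one colour from a finite colour set $\chi$. A clustering of $V$ is a partition of $V$ into nonempty clusters. A clustering $\mathcal F$ is fair if in every cluster $F\in\mathcal F$ the numbers of points of the different colours are in the same ratio as in $V$. The distance $\mathrm{dist}(\mathcal C,\mathcal C')$ of two clusterings is the number of unordered pairs $\{u,v\}$ of points of $V$ that lie in a common cluster in exactly one of $\mathcal C$ and $\mathcal C'$. A closest fair clustering to $\mathcal D$ is a fair clustering $\mathcal D^*$ that minimizes $\mathrm{dist}(\mathcal D,\cdot)$ among all fair clusterings, and a fair clustering $\mathcal F$ is $\gamma$-close to $\mathcal D$ if $\mathrm{dist}(\mathcal D,\mathcal F)\le\gamma\cdot\mathrm{dist}(\mathcal D,\mathcal D^*)$. **Theorem.** There are absolute constants $c\in\mathbb N$, $T, A, B\in\mathbb R$ and a deterministic algorithm (a fixed program for a word RAM, which may run with any word length of $w$ bits with $2^w\ge(|V|+|\chi|+2)^c$, every arithmetic operation, comparison, memory access, assignment and branch on words costing one step) such that the following holds for every coloured point set $V=\{0,\dots,n-1\}$ with colour set $\chi=\{0,\dots,k-1\}$ in which all colour groups have the same size, and every clustering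 $\mathcal D$ of $V$. Given $n$, $k$, and for each point its colour and a cluster number below $n$ (two points having the same cluster number iff they are together in $\mathcal D$), the algorithm halts and outputs, in the same format, a fair clustering $\mathcal F$ such that 1. if $n\ge 2$, the algorithm makes at most $T\,|V|\log_2|V|$ steps; 2. $\mathcal F$ is $\bigl(A\,|\chi|^{1.6}\,(\log_2|\chi|)^{2.81}\bigr)$-close to $\mathcal D$; 3. if $|\chi|$ is a power of two, $\mathcal F$ is $\bigl(B\,|\chi|^{1.6}\bigr)$-close to $\mathcal D$. -/

import Mathlib

/-! ### Clusterings, distance, fairness -/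

/-- A clustering of a finite point set `V`: a partition of `V` into nonempty clusters. -/
abbrev Clustering (V : Type*) [Fintype V] [DecidableEq V] :=
  Finpartition (Finset.univ : Finset V)

/-- `u ∼_C v`: the points `u` and `v` lie in a common cluster of `C`. -/
def Clustering.Together {V : Type*} [Fintype V] [DecidableEq V]
    (C : Clustering V) (u v : V) : Prop :=
  ∃ K ∈ C.parts, u ∈ K ∧ v ∈ K

/-- The number of unordered pairs `{u, v}` that are together in exactly one of `C`, `C'`. -/
noncomputable def Clustering.dist {V : Type*} [Fintype V] [DecidableEq V]
    (C C' : Clustering V) : ℕ :=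
  {e : Sym2 V | ∃ u v, e = s(u, v) ∧
    ((C.Together u v ∧ ¬ C'.Together u v) ∨ (¬ C.Together u v ∧ C'.Together u v))}.ncard

/-- The number of points of colour `c` in the set `S`. -/
def colorCount {V χ : Type*} [DecidableEq χ] (σ : V → χ) (S : Finset V) (c : χ) : ℕ :=
  (S.filter fun v => σ v = c).card

/-- A clustering is fair if in each of its clusters the numbers of points of the colours are in
the same ratio as in the whole point set (the equality of ratios is cross-multiplied). -/
def Clustering.IsFair {V χ : Type*} [Fintype V] [DecidableEq V] [DecidableEq χ]
    (σ : V → χ) (F : Clustering V) : Prop :=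
  ∀ K ∈ F.parts, ∀ a b : χ,
    colorCount σ K a * colorCount σ Finset.univ b =
      colorCount σ K b * colorCount σ Finset.univ a

/-- `N` is a closest fair clustering to `D`. -/
def Clustering.IsClosestFair {V χ : Type*} [Fintype V] [DecidableEq V] [DecidableEq χ]
    (σ : V → χ) (D N : Clustering V) : Prop :=
  N.IsFair σ ∧ ∀ F : Clustering V, F.IsFair σ → D.dist N ≤ D.dist F

/-- `F` is a `γ`-close fair clustering to `D`. -/
def Clustering.IsCloseFair {V χ : Type*} [Fintype V] [DecidableEq V] [DecidableEq χ]
    (σ : V → χ) (γ : ℝ) (D F : Clustering V) : Prop :=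
  F.IsFair σ ∧ ∀ N : Clustering V, Clustering.IsClosestFair σ D N →
    (D.dist F : ℝ) ≤ γ * (D.dist N : ℝ)

/-- A closest fair clustering always exists. -/
theorem Clustering.exists_isClosestFair {V χ : Type*} [Fintype V] [DecidableEq V]
    [DecidableEq χ] (σ : V → χ) (D : Clustering V) :
    ∃ N : Clustering V, Clustering.IsClosestFair σ D N := by
  have hfair : ∃ F : Clustering V, F.IsFair σ := by
    rcases (Finset.univ : Finset V).eq_empty_or_nonempty with h | h
    · refine ⟨D, fun K hK => ?_⟩
      have h1 : K ⊆ Finset.univ := D.le hK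
      rw [h, Finset.subset_empty] at h1
      subst h1
      exact absurd hK D.bot_notMem
    · refine ⟨Finpartition.indiscrete h.ne_empty, fun K hK a b => ?_⟩
      have hK' : K = Finset.univ := by simpa [Finpartition.indiscrete] using hK
      subst hK'
      exact mul_comm _ _
  obtain ⟨N, hN, hmin⟩ := WellFounded.has_min
    (InvImage.wf (fun F : Clustering V => D.dist F) Nat.lt_wfRel.wf)
    {F : Clustering V | F.IsFair σ} hfair
  exact ⟨N, hN, fun F hF => not_lt.mp (hmin F hF)⟩

/-! ### The machine model: a word RAM with `w`-bit words

A program is a fixed text. It uses finitely many registers, which hold one word each, and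
finitely many arrays, each indexed by words and with words as entries. All operations are on
words and every operation, memory access, assignment and branch costs one step. -/

namespace WordRAM

/-- The arithmetic operations and comparisons. -/
inductive BinOp where
  | add | sub | mul | div | lt | eq

/-- The result of an operation on `w`-bit words: sums and products are modulo `2 ^ w`,
differences are truncated at `0`, quotients are rounded down (and are `0` for divisor `0`),
and comparisons give `1` for true and `0` for false. -/
def BinOp.eval (w : ℕ) : BinOp → ℕ → ℕ → ℕ
  | .add, x, y => (x + y) % 2 ^ w
  | .sub, x, y => x - y
  | .mul, x, y => (x * y) % 2 ^ w
  | .div, x, y => x / y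
  | .lt, x, y => if x < y then 1 else 0
  | .eq, x, y => if x = y then 1 else 0

/-- A memory configuration: the registers, and for each array number the array's entries. -/
structure State where
  reg : ℕ → ℕ
  mem : ℕ → ℕ → ℕ

/-- Write the word `x` into register `r`. -/
def State.setReg (s : State) (r x : ℕ) : State :=
  ⟨Function.update s.reg r x, s.mem⟩

/-- Write the word `x` into the array `a` at index `i`. -/
def State.setMem (s : State) (a i x : ℕ) : State :=
  ⟨s.reg, Function.update s.mem a (Function.update (s.mem a) i x)⟩

/-- Expressions; `load a i` is the entry of the array `a` at index `i`. -/
inductive Expr where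
  | const (x : ℕ)
  | reg (r : ℕ)
  | load (a : ℕ) (i : Expr)
  | op (o : BinOp) (x y : Expr)

/-- The value of an expression. -/
def Expr.eval (w : ℕ) (s : State) : Expr → ℕ
  | .const x => x % 2 ^ w
  | .reg r => s.reg r
  | .load a i => s.mem a (i.eval w s)
  | .op o x y => o.eval w (x.eval w s) (y.eval w s)

/-- The number of steps it takes to evaluate an expression. -/
def Expr.cost : Expr → ℕ
  | .const _ => 1
  | .reg _ => 1
  | .load _ i => i.cost + 1
  | .op _ x y => x.cost + y.cost + 1

/-- Programs. The condition `e` of `cond` and `loop` holds if its value is nonzero. -/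
inductive Prog where
  | assign (r : ℕ) (e : Expr)
  | store (a : ℕ) (i e : Expr)
  | seq (p q : Prog)
  | cond (e : Expr) (p q : Prog)
  | loop (e : Expr) (p : Prog)

/-- `Exec w p s t s'`: on a machine with `w`-bit words, the program `p` started in `s` halts in
`s'` after exactly `t` steps. -/
inductive Exec (w : ℕ) : Prog → State → ℕ → State → Prop where
  | assign (r : ℕ) (e : Expr) (s : State) :
      Exec w (.assign r e) s (e.cost + 1) (s.setReg r (e.eval w s))
  | store (a : ℕ) (i e : Expr) (s : State) :
      Exec w (.store a i e) s (i.cost + e.cost + 1)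
        (s.setMem a (i.eval w s) (e.eval w s))
  | seq {p q : Prog} {s s' s'' : State} {t t' : ℕ} :
      Exec w p s t s' → Exec w q s' t' s'' → Exec w (.seq p q) s (t + t') s''
  | cond_true {e : Expr} {p q : Prog} {s s' : State} {t : ℕ} :
      e.eval w s ≠ 0 → Exec w p s t s' → Exec w (.cond e p q) s (e.cost + 1 + t) s'
  | cond_false {e : Expr} {p q : Prog} {s s' : State} {t : ℕ} :
      e.eval w s = 0 → Exec w q s t s' → Exec w (.cond e p q) s (e.cost + 1 + t) s'
  | loop_true {e : Expr} {p : Prog} {s s' s'' : State} {t t' : ℕ} :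
      e.eval w s ≠ 0 → Exec w p s t s' → Exec w (.loop e p) s' t' s'' →
        Exec w (.loop e p) s (e.cost + 1 + t + t') s''
  | loop_false {e : Expr} {p : Prog} {s : State} :
      e.eval w s = 0 → Exec w (.loop e p) s (e.cost + 1) s

/-- The machine is deterministic. -/
theorem Exec.deterministic {w : ℕ} {p : Prog} {s s₁ s₂ : State} {t₁ t₂ : ℕ}
    (h₁ : Exec w p s t₁ s₁) (h₂ : Exec w p s t₂ s₂) : t₁ = t₂ ∧ s₁ = s₂ := by
  induction h₁ generalizing t₂ s₂ with
  | assign => cases h₂; exact ⟨rfl, rfl⟩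
  | store => cases h₂; exact ⟨rfl, rfl⟩
  | seq _ _ ih ih' =>
    cases h₂ with
    | seq g g' =>
      obtain ⟨rfl, rfl⟩ := ih g
      obtain ⟨rfl, rfl⟩ := ih' g'
      exact ⟨rfl, rfl⟩
  | cond_true he _ ih =>
    cases h₂ with
    | cond_true _ g => obtain ⟨rfl, rfl⟩ := ih g; exact ⟨rfl, rfl⟩
    | cond_false he' _ => exact absurd he' he
  | cond_false he _ ih =>
    cases h₂ with
    | cond_true he' _ => exact absurd he he'
    | cond_false _ g => obtain ⟨rfl, rfl⟩ := ih g; exact ⟨rfl, rfl⟩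
  | loop_true he _ _ ih ih' =>
    cases h₂ with
    | loop_true _ g g' =>
      obtain ⟨rfl, rfl⟩ := ih g
      obtain ⟨rfl, rfl⟩ := ih' g'
      exact ⟨rfl, rfl⟩
    | loop_false he' => exact absurd he' he
  | loop_false he =>
    cases h₂ with
    | loop_true he' _ _ => exact absurd he he'
    | loop_false _ => exact ⟨rfl, rfl⟩

end WordRAM

/-! ### Input and output format -/

/-- The array `f` encodes the clustering `C` of the points `0, …, n - 1`: its first `n` entries
are cluster numbers below `n`, and two points are together iff their cluster numbers agree. -/
def Encodes {n : ℕ} (f : ℕ → ℕ) (C : Clustering (Fin n)) : Prop :=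
  (∀ v : Fin n, f v < n) ∧ ∀ u v : Fin n, f u = f v ↔ C.Together u v

/-- The initial configuration: register `0` holds the number `n` of points, register `1` the
number `k` of colours, array `0` the cluster numbers and array `1` the colours of the points;
everything else is `0`. -/
def inputState {n k : ℕ} (σ : Fin n → Fin k) (f : ℕ → ℕ) : WordRAM.State where
  reg r := if r = 0 then n else if r = 1 then k else 0
  mem a i := if h : i < n then
      (if a = 0 then f i else if a = 1 then (σ ⟨i, h⟩ : ℕ) else 0)
    else 0

namespace FairClustering

open Finset

/-! ### The clustering computed by the algorithm

The points are `0, …, n - 1`, the point `v` has the colour `g v` and lies in the cluster `f v`. -/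

/-! A linear-time `4 (k - 1)`-approximation suffices: this factor is at most `4 k ^ 1.6`, the
logarithm is at least `1` for `k ≥ 2`, and the factor vanishes for `k = 1`.

Number the points of each colour within each cluster. The points of one rank form a level, and full
levels, with all `k` colours, stay in their cluster. The remaining points are the surplus. Full
levels use the colours equally, so the surplus of the whole set does too (`card_surplus_eq`);
numbering it per colour cuts it into clusters with one point of each colour.

Let a fair `N` disagree with `D` on `e u` pairs at the point `u`. The rarest colour of a cluster has
no surplus there, whereas `N` balances all colours. Hence each other colour has surplus at most `e
u` in the cluster of `u`, and the total surplus there is at most `(k - 1) * e u`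
(`card_surplus_le`). The algorithm separates a balanced point only from the surplus of its cluster.
The cost at a surplus point is bounded through the size of its old cluster, and double counting
turns the sum of these sizes into a sum of surpluses (`sum_card_le`).

On the machine, three passes over the points compute the ranks, the keys and a representative of
each key (`exists_exec_program`). -/

theorem exists_count_eq {p : ℕ → Prop} [DecidablePred p] {r n : ℕ} (h : r < Nat.count p n) :
    ∃ v < n, p v ∧ Nat.count p v = r := by
  -- `Nat.nth` takes a default value past the end of a finite set, so `r` has to be shown to be in
  -- range.
  have hr : ∀ hf : (Set.ofPred p).Finite, r < #hf.toFinset := fun hf =>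
    h.trans_le (Nat.count_le_card hf n)
  exact ⟨Nat.nth p r, Nat.nth_lt_of_lt_count h, Nat.nth_mem r hr, Nat.count_nth hr⟩

/-- The number of earlier points with the cluster and the colour of `v`. -/
def rank (f g : ℕ → ℕ) (v : ℕ) : ℕ := Nat.count (fun u => f u = f v ∧ g u = g v) v

/-- The number of points of rank `r` in the cluster `x`. -/
def level (f g : ℕ → ℕ) (n x r : ℕ) : ℕ := Nat.count (fun u => f u = x ∧ rank f g u = r) n

/-- All colours have a point of the rank of `v` in the cluster of `v`. -/
def IsBalanced (f g : ℕ → ℕ) (n k v : ℕ) : Prop := level f g n (f v) (rank f g v) = k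

instance (f g : ℕ → ℕ) (n k v : ℕ) : Decidable (IsBalanced f g n k v) :=
  inferInstanceAs (Decidable (_ = _))

/-- The number of earlier unbalanced points with the colour of `v`. -/
def surplusRank (f g : ℕ → ℕ) (n k v : ℕ) : ℕ :=
  Nat.count (fun u => ¬ IsBalanced f g n k u ∧ g u = g v) v

/-- The cluster that is assigned to `v`: the balanced points of a cluster stay together, the
others are grouped by their surplus rank. -/
def key (f g : ℕ → ℕ) (n k v : ℕ) : ℕ :=
  if IsBalanced f g n k v then f v else n + surplusRank f g n k v

variable {f g : ℕ → ℕ} {n k : ℕ}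

theorem rank_le (v : ℕ) : rank f g v ≤ v := Nat.count_le _

theorem surplusRank_le (v : ℕ) : surplusRank f g n k v ≤ v := Nat.count_le _

theorem rank_inj {u v : ℕ} (hf : f u = f v) (hg : g u = g v) (h : rank f g u = rank f g v) :
    u = v := by
  unfold rank at h
  rw [hf, hg] at h
  exact Nat.count_injective (p := fun w => f w = f v ∧ g w = g v) ⟨hf, hg⟩ ⟨rfl, rfl⟩ h

theorem surplusRank_inj {u v : ℕ} (hu : ¬ IsBalanced f g n k u) (hv : ¬ IsBalanced f g n k v)
    (hg : g u = g v) (h : surplusRank f g n k u = surplusRank f g n k v) : u = v := by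
  unfold surplusRank at h
  rw [hg] at h
  exact Nat.count_injective (p := fun w => ¬ IsBalanced f g n k w ∧ g w = g v)
    ⟨hu, hg⟩ ⟨hv, rfl⟩ h

theorem exists_rank_eq {x a r : ℕ} (h : r < #{v ∈ range n | f v = x ∧ g v = a}) :
    ∃ v < n, f v = x ∧ g v = a ∧ rank f g v = r := by
  rw [← Nat.count_eq_card_filter_range] at h
  obtain ⟨v, hv, ⟨rfl, rfl⟩, h⟩ := exists_count_eq h
  exact ⟨v, hv, rfl, rfl, h⟩

theorem rank_lt_card {v : ℕ} (hv : v < n) :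
    rank f g v < #{u ∈ range n | f u = f v ∧ g u = g v} := by
  rw [← Nat.count_eq_card_filter_range]
  exact Nat.count_strict_mono (p := fun u => f u = f v ∧ g u = g v) ⟨rfl, rfl⟩ hv

/-- Within a cluster, points of equal rank have different colours by `rank_inj`, so counting points
is counting colours. -/
theorem level_eq_card_image (x r : ℕ) :
    level f g n x r = #({u ∈ range n | f u = x ∧ rank f g u = r}.image g) := by
  rw [level, Nat.count_eq_card_filter_range, card_image_of_injOn]
  intro u hu v hv h
  simp only [coe_filter, mem_range, Set.mem_ofPred_eq] at hu hv
  exact rank_inj (hu.2.1.trans hv.2.1.symm) h (hu.2.2.trans hv.2.2.symm)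

theorem level_eq_iff (hg : ∀ v < n, g v < k) {x r : ℕ} :
    level f g n x r = k ↔ ∀ a < k, ∃ v < n, f v = x ∧ g v = a ∧ rank f g v = r := by
  have hsub : {u ∈ range n | f u = x ∧ rank f g u = r}.image g ⊆ range k := by
    intro a ha
    simp only [mem_image, mem_filter, mem_range] at ha ⊢
    obtain ⟨u, hu, rfl⟩ := ha
    exact hg u hu.1
  rw [level_eq_card_image]
  constructor
  · intro h a ha
    have heq := eq_of_subset_of_card_le hsub (by simp [h])
    have : a ∈ {u ∈ range n | f u = x ∧ rank f g u = r}.image g := by simpa [heq] using ha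
    simp only [mem_image, mem_filter, mem_range] at this
    obtain ⟨u, hu, rfl⟩ := this
    exact ⟨u, hu.1, hu.2.1, rfl, hu.2.2⟩
  · intro h
    have heq : {u ∈ range n | f u = x ∧ rank f g u = r}.image g = range k := by
      refine hsub.antisymm fun a ha => ?_
      obtain ⟨u, h1, h2, h3, h4⟩ := h a (by simpa using ha)
      simp only [mem_image, mem_filter, mem_range]
      exact ⟨u, ⟨h1, h2, h4⟩, h3⟩
    simp [heq]

/-! ### Colour counts of balanced and surplus points -/

theorem card_balanced (hg : ∀ v < n, g v < k) {x a : ℕ} (ha : a < k) :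
    #{v ∈ range n | (f v = x ∧ IsBalanced f g n k v) ∧ g v = a} =
      #{r ∈ range n | level f g n x r = k} := by
  -- Each full level contains exactly one point of colour `a`. The resulting count does not depend
  -- on `a`, which makes the balanced part of a cluster fair.
  refine card_bij (fun v _ => rank f g v) ?_ ?_ ?_
  · intro v hv
    simp only [mem_filter, mem_range] at hv ⊢
    obtain ⟨hv, ⟨rfl, hb⟩, -⟩ := hv
    exact ⟨(rank_le v).trans_lt hv, hb⟩
  · intro u hu v hv h
    simp only [mem_filter, mem_range] at hu hv
    exact rank_inj (hu.2.1.1.trans hv.2.1.1.symm) (hu.2.2.trans hv.2.2.symm) h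
  · intro r hr
    simp only [mem_filter, mem_range] at hr
    obtain ⟨v, hv, rfl, hva, rfl⟩ := (level_eq_iff hg).1 hr.2 a ha
    exact ⟨v, mem_filter.2 ⟨mem_range.2 hv, ⟨rfl, hr.2⟩, hva⟩, rfl⟩

/-- Some colour has no surplus in the cluster `x`. -/
theorem exists_forall_isBalanced (hg : ∀ v < n, g v < k) (hk : 0 < k) (x : ℕ) :
    ∃ b < k, ∀ v < n, f v = x → g v = b → IsBalanced f g n k v := by
  -- Take a rarest colour of the cluster: every rank that occurs in it occurs in all other colours.
  obtain ⟨b, hb, hmin⟩ := exists_min_image (range k)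
    (fun a => #{v ∈ range n | f v = x ∧ g v = a}) ⟨0, by simpa using hk⟩
  refine ⟨b, by simpa using hb, ?_⟩
  rintro v hv rfl rfl
  refine (level_eq_iff hg).2 fun a ha => exists_rank_eq ?_
  exact (rank_lt_card hv).trans_le (hmin a (by simpa using ha))

/-- For the rarest colour `b`, all points are balanced, and each colour `a` has equally many
balanced points, disjoint from its surplus. -/
theorem exists_card_surplus_add_le (hg : ∀ v < n, g v < k) (hk : 0 < k) (x : ℕ) :
    ∃ b < k, ∀ a < k,
      #{v ∈ range n | f v = x ∧ ¬ IsBalanced f g n k v ∧ g v = a} +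
        #{v ∈ range n | f v = x ∧ g v = b} ≤ #{v ∈ range n | f v = x ∧ g v = a} := by
  obtain ⟨b, hb, hbal⟩ := exists_forall_isBalanced (f := f) hg hk x
  refine ⟨b, hb, fun a ha => ?_⟩
  have h1 : #{v ∈ range n | f v = x ∧ g v = b} =
      #{v ∈ range n | (f v = x ∧ IsBalanced f g n k v) ∧ g v = a} := by
    rw [card_balanced hg ha, ← card_balanced hg hb]
    congr 1
    ext v
    simp only [mem_filter, mem_range]
    exact ⟨fun h => ⟨h.1, ⟨h.2.1, hbal v h.1 h.2.1 h.2.2⟩, h.2.2⟩,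
      fun h => ⟨h.1, h.2.1.1, h.2.2⟩⟩
  rw [h1, ← card_union_of_disjoint]
  · refine card_le_card fun v hv => ?_
    simp only [mem_union, mem_filter] at hv ⊢
    tauto
  · rw [disjoint_left]
    intro v hu hv
    simp only [mem_filter] at hu hv
    exact hu.2.2.1 hv.2.1.2

/-- The balanced points are equally many in each colour, cluster by cluster; subtract them from the
equal colour groups. -/
theorem card_surplus_eq (hf : ∀ v < n, f v < n) (hg : ∀ v < n, g v < k)
    (hcol : ∀ a < k, ∀ b < k, #{v ∈ range n | g v = a} = #{v ∈ range n | g v = b})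
    {a b : ℕ} (ha : a < k) (hb : b < k) :
    #{v ∈ range n | ¬ IsBalanced f g n k v ∧ g v = a} =
      #{v ∈ range n | ¬ IsBalanced f g n k v ∧ g v = b} := by
  have hbal : ∀ a < k, #{v ∈ range n | g v = a ∧ IsBalanced f g n k v} =
      ∑ x ∈ range n, #{r ∈ range n | level f g n x r = k} := by
    intro a ha
    rw [card_eq_sum_card_fiberwise (f := f) (t := range n)]
    · refine sum_congr rfl fun x _ => ?_
      rw [← card_balanced hg ha, filter_filter]
      congr 1
      ext v
      simp only [mem_filter]
      tauto
    · intro v hv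
      simp only [coe_filter, mem_range, Set.mem_ofPred_eq, coe_range, Set.mem_Iio] at hv ⊢
      exact hf v hv.1
  have hsplit : ∀ a, #{v ∈ range n | g v = a ∧ IsBalanced f g n k v} +
      #{v ∈ range n | ¬ IsBalanced f g n k v ∧ g v = a} = #{v ∈ range n | g v = a} := by
    intro a
    rw [← card_filter_add_card_filter_not (s := {v ∈ range n | g v = a})
      (fun v => IsBalanced f g n k v), filter_filter, filter_filter]
    simp only [and_comm]
  have h1 := hsplit a
  have h2 := hsplit b
  have h3 := hcol a ha b hb
  rw [hbal a ha] at h1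
  rw [hbal b hb] at h2
  omega

theorem card_surplusRank (t a : ℕ) :
    #{v ∈ range n | (¬ IsBalanced f g n k v ∧ surplusRank f g n k v = t) ∧ g v = a} =
      if t < #{v ∈ range n | ¬ IsBalanced f g n k v ∧ g v = a} then 1 else 0 := by
  split_ifs with h
  · rw [← Nat.count_eq_card_filter_range] at h
    obtain ⟨v, hv, ⟨hb, rfl⟩, h⟩ := exists_count_eq h
    rw [card_eq_one]
    refine ⟨v, ?_⟩
    ext u
    simp only [mem_filter, mem_range, mem_singleton]
    constructor
    · rintro ⟨-, ⟨hu, hr⟩, hug⟩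
      exact surplusRank_inj hu hb hug (hr.trans h.symm)
    · rintro rfl
      exact ⟨hv, ⟨hb, h⟩, rfl⟩
  · rw [card_eq_zero, filter_eq_empty_iff]
    rintro v hv ⟨⟨hb, rfl⟩, rfl⟩
    rw [← Nat.count_eq_card_filter_range] at h
    exact h (Nat.count_strict_mono (p := fun u => ¬ IsBalanced f g n k u ∧ g u = g v)
      ⟨hb, rfl⟩ (mem_range.1 hv))

/-! ### The new clusters are fair -/

theorem key_eq_iff_of_lt (hf : ∀ v < n, f v < n) {v x : ℕ} (hv : v < n) (hx : x < n) :
    key f g n k v = x ↔ f v = x ∧ IsBalanced f g n k v := by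
  have := hf v hv
  unfold key
  split_ifs with h
  · simp [h]
  · simp only [h, and_false, iff_false]
    omega

theorem key_eq_add_iff (hf : ∀ v < n, f v < n) {v t : ℕ} (hv : v < n) :
    key f g n k v = n + t ↔ ¬ IsBalanced f g n k v ∧ surplusRank f g n k v = t := by
  have := hf v hv
  unfold key
  split_ifs with h
  · simp only [h, not_true_eq_false, false_and, iff_false]
    omega
  · simp [h]

/-- Keys below `n` collect the full levels of an old cluster. Any other key collects at most one
surplus point per colour, and since the surpluses have equal size, either all colours contribute or
none does. -/
theorem card_key_eq (hf : ∀ v < n, f v < n) (hg : ∀ v < n, g v < k)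
    (hcol : ∀ a < k, ∀ b < k, #{v ∈ range n | g v = a} = #{v ∈ range n | g v = b})
    (y : ℕ) {a b : ℕ} (ha : a < k) (hb : b < k) :
    #{v ∈ range n | key f g n k v = y ∧ g v = a} =
      #{v ∈ range n | key f g n k v = y ∧ g v = b} := by
  rcases lt_or_ge y n with hy | hy
  · have h : ∀ c < k, #{v ∈ range n | key f g n k v = y ∧ g v = c} =
        #{r ∈ range n | level f g n y r = k} := by
      intro c hc
      rw [← card_balanced hg hc]
      congr 1
      refine filter_congr fun v hv => ?_
      rw [key_eq_iff_of_lt hf (mem_range.1 hv) hy]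
    rw [h a ha, h b hb]
  · obtain ⟨t, rfl⟩ := Nat.exists_eq_add_of_le hy
    have h : ∀ c, #{v ∈ range n | key f g n k v = n + t ∧ g v = c} =
        if t < #{v ∈ range n | ¬ IsBalanced f g n k v ∧ g v = c} then 1 else 0 := by
      intro c
      rw [← card_surplusRank]
      congr 1
      refine filter_congr fun v hv => ?_
      rw [key_eq_add_iff hf (mem_range.1 hv)]
    rw [h a, h b, card_surplus_eq hf hg hcol ha hb]

theorem card_key_le (hf : ∀ v < n, f v < n) (hg : ∀ v < n, g v < k) {v : ℕ}
    (hb : ¬ IsBalanced f g n k v) : #{u ∈ range n | key f g n k u = key f g n k v} ≤ k := by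
  refine (card_le_card_of_injOn (t := range k) g (fun u hu => ?_)
    fun u hu u' hu' h => ?_).trans_eq (card_range k)
  · simp only [coe_filter, mem_range, Set.mem_ofPred_eq, coe_range, Set.mem_Iio] at hu ⊢
    exact hg u hu.1
  · have hkey : key f g n k v = n + surplusRank f g n k v := if_neg hb
    simp only [coe_filter, mem_range, Set.mem_ofPred_eq, hkey] at hu hu'
    rw [key_eq_add_iff hf hu.1] at hu
    rw [key_eq_add_iff hf hu'.1] at hu'
    exact surplusRank_inj hu.2.1 hu'.2.1 h (hu.2.2.trans hu'.2.2.symm)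

end FairClustering

namespace FairClustering

open Finset

/-! ### The distance to a closest fair clustering -/

section Distance

variable {V : Type*} [Fintype V] [DecidableEq V]

/-- The pairs in disagreement are the edges of a graph, and this is the handshake lemma. It allows
comparing distances point by point. -/
theorem two_mul_dist {ι κ : Type*} [DecidableEq ι] [DecidableEq κ] {C C' : Clustering V}
    {p : V → ι} {q : V → κ} (hp : ∀ u v, p u = p v ↔ C.Together u v)
    (hq : ∀ u v, q u = q v ↔ C'.Together u v) :
    2 * C.dist C' = ∑ u, #{v | ¬ (p u = p v ↔ q u = q v)} := by
  classical
  let G : SimpleGraph V :=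
    { Adj := fun u v => ¬ (p u = p v ↔ q u = q v)
      symm := ⟨fun u v h => by rwa [eq_comm (a := p v), eq_comm (a := q v)]⟩
      loopless := ⟨fun u h => h (by simp)⟩ }
  have hG : ∀ u v, G.Adj u v ↔ ¬ (p u = p v ↔ q u = q v) := fun _ _ => Iff.rfl
  have h1 : C.dist C' = #G.edgeFinset := by
    rw [Clustering.dist, ← Set.ncard_coe_finset, SimpleGraph.coe_edgeFinset]
    congr 1
    ext e
    induction e with
    | h u v =>
      rw [SimpleGraph.mem_edgeSet, hG, hp, hq]
      constructor
      · rintro ⟨u', v', he, h⟩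
        rcases Sym2.eq_iff.1 he with ⟨rfl, rfl⟩ | ⟨rfl, rfl⟩
        · tauto
        · rw [← hp, ← hq] at h ⊢
          rw [eq_comm (a := p u), eq_comm (a := q u)]
          tauto
      · intro h
        exact ⟨u, v, rfl, by tauto⟩
  rw [h1, ← SimpleGraph.sum_degrees_eq_twice_card_edges]
  refine sum_congr rfl fun u _ => ?_
  rw [← SimpleGraph.card_neighborFinset_eq_degree]
  congr 1
  ext v
  simp [hG]

theorem part_eq_part_iff_together (C : Clustering V) (u v : V) :
    C.part u = C.part v ↔ C.Together u v := by
  rw [← C.mem_part_iff_part_eq_part (mem_univ u) (mem_univ v)]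
  constructor
  · intro h
    exact ⟨C.part v, C.part_mem.2 (mem_univ v), h, C.mem_part (mem_univ v)⟩
  · rintro ⟨K, hK, hu, hv⟩
    rwa [C.part_eq_of_mem hK hv]

theorem mem_part_iff_part_eq (C : Clustering V) (u v : V) :
    v ∈ C.part u ↔ C.part u = C.part v := by
  rw [C.mem_part_iff_part_eq_part (mem_univ v) (mem_univ u), eq_comm]

/-! ### Colour counts in fair clusters -/

theorem sum_colorCount {V χ : Type*} [Fintype χ] [DecidableEq χ] (σ : V → χ)
    (S : Finset V) : ∑ a, colorCount σ S a = #S :=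
  (card_eq_sum_card_fiberwise fun _ _ => mem_coe.2 (mem_univ _)).symm

theorem colorCount_le_add_card_sdiff {V χ : Type*} [DecidableEq V] [DecidableEq χ]
    (σ : V → χ) (S S' : Finset V) (a : χ) :
    colorCount σ S a ≤ colorCount σ S' a + #(S \ S') := by
  refine (card_le_card (t := S'.filter (fun v => σ v = a) ∪ S \ S') fun v hv => ?_).trans
    (card_union_le _ _)
  simp only [mem_filter, mem_union, mem_sdiff] at hv ⊢
  tauto

variable {χ : Type*} [DecidableEq χ]

theorem colorCount_part_eq {σ : V → χ} (hσ : ∀ a b, colorCount σ univ a = colorCount σ univ b)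
    {N : Clustering V} (hN : N.IsFair σ) (u : V) (a b : χ) :
    colorCount σ (N.part u) a = colorCount σ (N.part u) b := by
  have h := hN _ (N.part_mem.2 (mem_univ u)) a b
  -- The common size of the colour groups can be cancelled because the colour of `u` occurs.
  have hpos : 0 < colorCount σ univ a := by
    rw [hσ a (σ u)]
    exact card_pos.2 ⟨u, by simp⟩
  rw [hσ b a] at h
  exact Nat.eq_of_mul_eq_mul_right hpos h

variable [Fintype χ]

theorem card_le_card_part {σ : V → χ} (hσ : ∀ a b, colorCount σ univ a = colorCount σ univ b)
    {N : Clustering V} (hN : N.IsFair σ) (u : V) : Fintype.card χ ≤ #(N.part u) := by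
  rw [← sum_colorCount σ, ← card_univ, card_eq_sum_ones]
  refine sum_le_sum fun a _ => ?_
  rw [colorCount_part_eq hσ hN u a (σ u)]
  exact card_pos.2 ⟨u, by simp [N.mem_part (mem_univ u)]⟩

variable {ι κ : Type*} [DecidableEq ι] [DecidableEq κ]

theorem card_filter_ne (p : V → ι) (N : Clustering V) (u : V) :
    #{v | ¬ (p u = p v ↔ N.part u = N.part v)} =
      #(({v | p u = p v} : Finset V) \ N.part u) + #(N.part u \ ({v | p u = p v} : Finset V)) := by
  rw [← card_union_of_disjoint disjoint_sdiff_sdiff]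
  congr 1
  ext v
  simp only [mem_filter, mem_univ, true_and, mem_union, mem_sdiff, mem_part_iff_part_eq]
  tauto

/-- A fair clustering `N` has to separate each point `u` from as many points, up to a factor
`k - 1`, as there are surplus points in the cluster of `u`. -/
theorem card_surplus_le {σ : V → χ} (hσ : ∀ a b, colorCount σ univ a = colorCount σ univ b)
    {N : Clustering V} (hN : N.IsFair σ) {p : V → ι} {bal : V → Prop} [DecidablePred bal] {u : V}
    (hsur : ∃ b, ∀ a, colorCount σ {v | p u = p v ∧ ¬ bal v} a +
      colorCount σ {v | p u = p v} b ≤ colorCount σ {v | p u = p v} a) :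
    #{v | p u = p v ∧ ¬ bal v} ≤
      (Fintype.card χ - 1) * #{v | ¬ (p u = p v ↔ N.part u = N.part v)} := by
  obtain ⟨b, hb⟩ := hsur
  -- For `a = b`, the hypothesis forces the surplus to be zero; dropping this term gives `k - 1`
  -- instead of `k`.
  rw [← sum_colorCount σ, ← add_sum_erase _ (fun a => colorCount σ _ a) (mem_univ b)]
  have h0 := hb b
  have h1 : ∀ a ∈ univ.erase b, colorCount σ {v | p u = p v ∧ ¬ bal v} a ≤
      #{v | ¬ (p u = p v ↔ N.part u = N.part v)} := by
    intro a _
    -- With `X` the cluster of `u`, passing from `X` to `N.part u` in colour `a` and back in colour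
    -- `b` costs at most `#(X \ N.part u) + #(N.part u \ X)`, the number of disagreements at `u`.
    have h1 := hb a
    have h2 := colorCount_le_add_card_sdiff σ {v | p u = p v} (N.part u) a
    have h3 := colorCount_le_add_card_sdiff σ (N.part u) {v | p u = p v} b
    have h4 := colorCount_part_eq hσ hN u a b
    have h5 := card_filter_ne p N u
    omega
  have h2 : ∑ a ∈ univ.erase b, colorCount σ {v | p u = p v ∧ ¬ bal v} a ≤ _ :=
    sum_le_card_nsmul _ _ _ h1
  rw [card_erase_of_mem (mem_univ b), card_univ, smul_eq_mul] at h2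
  omega

/-- Splitting off the surplus points of the clusters and grouping them into clusters with one
point of each colour is a `4 (k - 1)`-approximation. -/
theorem sum_card_le {σ : V → χ} (hσ : ∀ a b, colorCount σ univ a = colorCount σ univ b)
    {N : Clustering V} (hN : N.IsFair σ) {p : V → ι} {q : V → κ} {bal : V → Prop}
    [DecidablePred bal]
    (hsur : ∀ u, ∃ b, ∀ a, colorCount σ {v | p u = p v ∧ ¬ bal v} a +
      colorCount σ {v | p u = p v} b ≤ colorCount σ {v | p u = p v} a)
    (hbal : ∀ u v, bal u → bal v → (p u = p v ↔ q u = q v))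
    (hne : ∀ u v, bal u → ¬ bal v → q u ≠ q v)
    (hcard : ∀ u, ¬ bal u → #{v | q u = q v} ≤ Fintype.card χ) :
    ∑ u, #{v | ¬ (p u = p v ↔ q u = q v)} ≤
      4 * (Fintype.card χ - 1) * ∑ u, #{v | ¬ (p u = p v ↔ N.part u = N.part v)} := by
  set m := Fintype.card χ - 1 with hm
  set e : V → ℕ := fun u => #{v | ¬ (p u = p v ↔ N.part u = N.part v)} with he
  have hs : ∀ u, #{v | p u = p v ∧ ¬ bal v} ≤ m * e u := fun u => card_surplus_le hσ hN (hsur u)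
  have hpt : ∀ u, #{v | ¬ (p u = p v ↔ q u = q v)} ≤
      2 * (m * e u) + 2 * (if bal u then 0 else #{v | p u = p v}) := by
    intro u
    by_cases hu : bal u
    · have : #{v | ¬ (p u = p v ↔ q u = q v)} ≤ #{v | p u = p v ∧ ¬ bal v} := by
        refine card_le_card fun v hv => ?_
        simp only [mem_filter, mem_univ, true_and] at hv ⊢
        have h1 := hbal u v hu
        have h2 := hne u v hu
        tauto
      have := hs u
      simp only [hu, if_true]
      omega
    -- The new cluster of a surplus point has at most `k` points, hence no more than `N.part u`,
    -- whose size exceeds that of the old cluster by at most `e u`.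
    · have h1 : #{v | ¬ (p u = p v ↔ q u = q v)} ≤ #{v | p u = p v} + #{v | q u = q v} := by
        refine (card_le_card fun v hv => ?_).trans (card_union_le _ _)
        simp only [mem_union, mem_filter, mem_univ, true_and] at hv ⊢
        tauto
      have h2 := hcard u hu
      have h3 := card_le_card_part hσ hN u
      have h4 : #(N.part u) ≤ #{v | p u = p v} + e u := by
        have h5 : #(N.part u) ≤ #{v | p u = p v} + #(N.part u \ ({v | p u = p v} : Finset V)) := by
          rw [add_comm, ← tsub_le_iff_right]
          exact le_card_sdiff _ _
        have h6 : e u = _ := card_filter_ne p N u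
        omega
      -- If `m = 0`, then `hs` leaves no surplus at all, but `u` is a surplus point.
      have h5 : 0 < m := by
        by_contra! h0
        have h6 := hs u
        rw [Nat.le_zero.1 h0, zero_mul, Nat.le_zero, card_eq_zero, filter_eq_empty_iff] at h6
        exact h6 (mem_univ u) ⟨rfl, hu⟩
      have h6 : e u ≤ m * e u := Nat.le_mul_of_pos_left _ h5
      simp only [hu, if_false]
      omega
  -- Both sides count the pairs in a common cluster whose one designated member is surplus.
  have hdouble : ∑ u, (if bal u then 0 else #{v | p u = p v}) =
      ∑ u, #{v | p u = p v ∧ ¬ bal v} := by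
    simp only [card_filter]
    rw [sum_comm]
    refine sum_congr rfl fun u _ => ?_
    split_ifs with hu
    · simp [hu]
    · simp [hu, eq_comm]
  calc ∑ u, #{v | ¬ (p u = p v ↔ q u = q v)}
      ≤ ∑ u, (2 * (m * e u) + 2 * (if bal u then 0 else #{v | p u = p v})) :=
        sum_le_sum fun u _ => hpt u
    _ = 2 * ∑ u, m * e u + 2 * ∑ u, #{v | p u = p v ∧ ¬ bal v} := by
        rw [sum_add_distrib, ← mul_sum, ← hdouble, ← mul_sum univ _ 2]
    _ ≤ 2 * ∑ u, m * e u + 2 * ∑ u, m * e u := by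
        gcongr with u
        exact hs u
    _ = 4 * m * ∑ u, e u := by rw [← mul_sum]; ring

end Distance

end FairClustering

namespace FairClustering

open WordRAM

/-! ### The program -/

/-- Register `2` is the loop counter, running up to the number of points in register `0`. -/
def forPoints (body : Prog) : Prog :=
  .loop (.op .lt (.reg 2) (.reg 0))
    (.seq body (.assign 2 (.op .add (.reg 2) (.const 1))))

/-- The entry of the array `a` at the current point. -/
def cur (a : ℕ) : Expr := .load a (.reg 2)

/-- The index of the cluster and the colour of the current point. -/
def colorIdx : Expr := .op .add (.op .mul (cur 0) (.reg 1)) (cur 1)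

/-- The index of the cluster and the rank of the current point. -/
def levelIdx : Expr := .op .add (.op .mul (cur 0) (.reg 0)) (cur 4)

/-- Add one to the entry of the array `a` at index `i`. -/
def incr (a : ℕ) (i : Expr) : Prog := .store a i (.op .add (.load a i) (.const 1))

/-- Array `3` counts the points of each cluster and colour, array `4` holds the ranks and array
`5` counts the points of each cluster and rank. -/
def countRanks : Prog :=
  .seq (.store 4 (.reg 2) (.load 3 colorIdx)) (.seq (incr 3 colorIdx) (incr 5 levelIdx))

/-- Array `6` counts the unbalanced points of each colour, array `7` holds the keys and array `8`
a point of each key. -/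
def computeKeys : Prog :=
  .seq
    (.cond (.op .eq (.load 5 levelIdx) (.reg 1))
      (.store 7 (.reg 2) (cur 0))
      (.seq (.store 7 (.reg 2) (.op .add (.reg 0) (.load 6 (cur 1)))) (incr 6 (cur 1))))
    (.store 8 (cur 7) (.reg 2))

/-- Array `2` receives the output. -/
def writeOutput : Prog := .store 2 (.reg 2) (.load 8 (cur 7))

/-- The algorithm. -/
def program : Prog :=
  .seq (forPoints countRanks) (.seq (.assign 2 (.const 0))
    (.seq (forPoints computeKeys) (.seq (.assign 2 (.const 0)) (forPoints writeOutput))))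

/-! ### Correctness of the program -/

theorem add_eval_of_lt {w x y : ℕ} (h : x + y < 2 ^ w) : BinOp.add.eval w x y = x + y :=
  Nat.mod_eq_of_lt h

theorem mul_eval_of_lt {w x y : ℕ} (h : x * y < 2 ^ w) : BinOp.mul.eval w x y = x * y :=
  Nat.mod_eq_of_lt h

theorem const_eval_of_lt {w x : ℕ} (h : x < 2 ^ w) (s : State) : (Expr.const x).eval w s = x :=
  Nat.mod_eq_of_lt h

/-- In `s` the current point is `i`, and the input is in place. -/
structure AtPoint (f g : ℕ → ℕ) (n k i : ℕ) (s : State) : Prop where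
  reg0 : s.reg 0 = n
  reg1 : s.reg 1 = k
  reg2 : s.reg 2 = i
  mem0 : ∀ v < n, s.mem 0 v = f v
  mem1 : ∀ v < n, s.mem 1 v = g v

variable {f g : ℕ → ℕ} {n k : ℕ}

theorem AtPoint.of_eq {i : ℕ} {s s' : State} (h : AtPoint f g n k i s) (hr : s'.reg = s.reg)
    (h0 : s'.mem 0 = s.mem 0) (h1 : s'.mem 1 = s.mem 1) : AtPoint f g n k i s' :=
  ⟨hr ▸ h.reg0, hr ▸ h.reg1, hr ▸ h.reg2, h0 ▸ h.mem0, h1 ▸ h.mem1⟩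

theorem AtPoint.goto {i : ℕ} {s : State} (h : AtPoint f g n k i s) (j : ℕ) :
    AtPoint f g n k j (s.setReg 2 j) := by
  constructor <;> simp [State.setReg, h.reg0, h.reg1] <;> [exact h.mem0; exact h.mem1]

/-- The invariant rule: a property of the memory that holds for all points before the current
one is preserved by the loop. -/
theorem exists_exec_forPoints {w c : ℕ} (hw : n + 1 < 2 ^ w) {body : Prog}
    {Inv : ℕ → (ℕ → ℕ → ℕ) → Prop}
    (hbody : ∀ i < n, ∀ s, AtPoint f g n k i s → Inv i s.mem →
      ∃ t s', Exec w body s t s' ∧ t ≤ c ∧ AtPoint f g n k i s' ∧ Inv (i + 1) s'.mem)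
    {s : State} (hs : AtPoint f g n k 0 s) (hInv : Inv 0 s.mem) :
    ∃ t s', Exec w (forPoints body) s t s' ∧ t ≤ n * (c + 8) + 4 ∧
      AtPoint f g n k n s' ∧ Inv n s'.mem := by
  -- Induction on the number `d` of remaining points. A round costs `4` for the test and `4` for the
  -- increment besides the body; the final failing test costs `4`.
  suffices H : ∀ d i s, i + d = n → AtPoint f g n k i s → Inv i s.mem →
      ∃ t s', Exec w (forPoints body) s t s' ∧ t ≤ d * (c + 8) + 4 ∧
        AtPoint f g n k n s' ∧ Inv n s'.mem from H n 0 s (by simp) hs hInv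
  intro d
  induction d with
  | zero =>
    rintro i s rfl hs hInv
    refine ⟨_, s, Exec.loop_false ?_, by simp [Expr.cost], hs, hInv⟩
    simp [Expr.eval, BinOp.eval, hs.reg0, hs.reg2]
  | succ d ih =>
    intro i s hd hs hInv
    obtain ⟨t, s', he, ht, hs', hInv'⟩ := hbody i (by omega) s hs hInv
    have hincr : (Expr.op .add (.reg 2) (.const 1)).eval w s' = i + 1 := by
      rw [Expr.eval, const_eval_of_lt (by omega), Expr.eval, hs'.reg2,
        add_eval_of_lt (by omega)]
    obtain ⟨t', s'', he', ht', hs'', hInv''⟩ := ih (i + 1) (s'.setReg 2 (i + 1)) (by omega)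
      (hs'.goto _) hInv'
    refine ⟨_, s'', Exec.loop_true ?_ (he.seq (.assign _ _ _)) (hincr ▸ he'), ?_, hs'', hInv''⟩
    · have : i < n := by omega
      simp [Expr.eval, BinOp.eval, hs.reg0, hs.reg2, this]
    · simp only [Expr.cost]
      linarith

/-- What `countRanks` has achieved when the points before `i` are processed. -/
structure RanksUpTo (f g : ℕ → ℕ) (n k i : ℕ) (m : ℕ → ℕ → ℕ) : Prop where
  counts : ∀ x a, a < k → m 3 (x * k + a) = Nat.count (fun u => f u = x ∧ g u = a) i
  ranks : ∀ v < i, m 4 v = rank f g v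
  levels : ∀ x r, r < n → m 5 (x * n + r) = Nat.count (fun u => f u = x ∧ rank f g u = r) i
  surplus : ∀ a, m 6 a = 0

/-- What `computeKeys` has achieved when the points before `i` are processed. -/
structure KeysUpTo (f g : ℕ → ℕ) (n k i : ℕ) (m : ℕ → ℕ → ℕ) : Prop where
  ranks : ∀ v < n, m 4 v = rank f g v
  levels : ∀ x r, r < n → m 5 (x * n + r) = level f g n x r
  surplus : ∀ a, m 6 a = Nat.count (fun u => ¬ IsBalanced f g n k u ∧ g u = a) i
  keys : ∀ v < i, m 7 v = key f g n k v
  reps : ∀ v < i, m 8 (key f g n k v) < i ∧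
    key f g n k (m 8 (key f g n k v)) = key f g n k v

/-- What `writeOutput` has achieved when the points before `i` are processed. -/
structure OutputUpTo (f g : ℕ → ℕ) (n k i : ℕ) (m : ℕ → ℕ → ℕ) : Prop where
  keys : ∀ v < n, m 7 v = key f g n k v
  reps : ∀ v < n, m 8 (key f g n k v) < n ∧
    key f g n k (m 8 (key f g n k v)) = key f g n k v
  output : ∀ v < i, m 2 v = m 8 (key f g n k v)

/-! ### Flattened two-dimensional indices and absence of overflow -/

theorem mul_add_inj {x y r r' b : ℕ} (hr : r < b) (hr' : r' < b) :
    x * b + r = y * b + r' ↔ x = y ∧ r = r' := by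
  constructor
  · intro h
    have hx : x = y := by
      have h1 : (x * b + r) / b = x := by
        rw [mul_comm, Nat.mul_add_div (by omega), Nat.div_eq_of_lt hr, add_zero]
      have h2 : (y * b + r') / b = y := by
        rw [mul_comm, Nat.mul_add_div (by omega), Nat.div_eq_of_lt hr', add_zero]
      rw [← h1, h, h2]
    subst hx
    exact ⟨rfl, by omega⟩
  · rintro ⟨rfl, rfl⟩
    rfl

/-- The flattened indices are quadratic in `n + k`, which is why the exponent `2` suffices for the
word length. -/
theorem mul_add_lt {w x y b r : ℕ} (hw : (n + k + 2) ^ 2 ≤ 2 ^ w) (hx : x < n)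
    (hb : b ≤ n + k) (hr : r ≤ n + k) (hy : y ≤ x * b + r) : y < 2 ^ w := by
  have h : n * (n + k) + (n + k) < (n + k + 2) ^ 2 := by nlinarith
  refine (hy.trans ?_).trans_lt (h.trans_le hw)
  gcongr

theorem small_lt {w y : ℕ} (hw : (n + k + 2) ^ 2 ≤ 2 ^ w) (hy : y ≤ 2 * (n + k) + 3) :
    y < 2 ^ w := by
  refine (Nat.lt_of_le_of_lt hy ?_).trans_le hw
  nlinarith

theorem eval_cur (w a : ℕ) {i : ℕ} {s : State} (hs : AtPoint f g n k i s) :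
    (cur a).eval w s = s.mem a i := by
  simp [cur, Expr.eval, hs.reg2]

theorem eval_colorIdx {w i : ℕ} (hf : ∀ v < n, f v < n) (hg : ∀ v < n, g v < k)
    (hw : (n + k + 2) ^ 2 ≤ 2 ^ w) (hi : i < n) {s : State} (hs : AtPoint f g n k i s) :
    colorIdx.eval w s = f i * k + g i := by
  have h1 := hf i hi
  have h2 := hg i hi
  simp only [colorIdx, Expr.eval, eval_cur w _ hs, hs.reg1, hs.mem0 i hi, hs.mem1 i hi]
  rw [mul_eval_of_lt, add_eval_of_lt]
  · exact mul_add_lt hw h1 (Nat.le_add_left k n) (r := g i) (by omega) le_rfl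
  · exact mul_add_lt hw h1 (Nat.le_add_left k n) (Nat.zero_le _) le_rfl

theorem eval_levelIdx {w i : ℕ} (hf : ∀ v < n, f v < n)
    (hw : (n + k + 2) ^ 2 ≤ 2 ^ w) (hi : i < n) {s : State} (hs : AtPoint f g n k i s)
    (h4 : s.mem 4 i = rank f g i) : levelIdx.eval w s = f i * n + rank f g i := by
  have h1 := hf i hi
  have h2 := rank_le (f := f) (g := g) i
  simp only [levelIdx, Expr.eval, eval_cur w _ hs, hs.reg0, hs.mem0 i hi, h4]
  rw [mul_eval_of_lt, add_eval_of_lt]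
  · exact mul_add_lt hw h1 (Nat.le_add_right n k) (r := rank f g i) (by omega) le_rfl
  · exact mul_add_lt hw h1 (Nat.le_add_right n k) (Nat.zero_le _) le_rfl

theorem eval_incr {w a y : ℕ} {s : State} {e : Expr} {x : ℕ} (he : e.eval w s = x)
    (hx : s.mem a x = y) (hy : y + 1 < 2 ^ w) :
    (Expr.op .add (.load a e) (.const 1)).eval w s = y + 1 := by
  rw [Expr.eval, const_eval_of_lt (by omega), Expr.eval, he, hx, add_eval_of_lt hy]

theorem exec_incr {w a y x : ℕ} {s : State} {e : Expr} (he : e.eval w s = x)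
    (hx : s.mem a x = y) (hy : y + 1 < 2 ^ w) :
    Exec w (incr a e) s (2 * e.cost + 4) (s.setMem a x (y + 1)) := by
  have := Exec.store (w := w) a e (.op .add (.load a e) (.const 1)) s
  rw [he, eval_incr he hx hy, show e.cost + (Expr.op .add (.load a e) (.const 1)).cost + 1 =
    2 * e.cost + 4 by simp only [Expr.cost]; ring] at this
  exact this

theorem exec_store {w a x y : ℕ} {s : State} {e e' : Expr} (he : e.eval w s = x)
    (he' : e'.eval w s = y) :
    Exec w (.store a e e') s (e.cost + e'.cost + 1) (s.setMem a x y) := by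
  have := Exec.store (w := w) a e e' s
  rwa [he, he'] at this

theorem AtPoint.setMem {i : ℕ} {s : State} (h : AtPoint f g n k i s) {a : ℕ} (ha : 2 ≤ a)
    (x y : ℕ) : AtPoint f g n k i (s.setMem a x y) := by
  refine h.of_eq rfl ?_ ?_ <;> exact Function.update_of_ne (by omega) _ _

/-! ### The loop bodies preserve their invariants -/

theorem exists_exec_countRanks {w i : ℕ} (hf : ∀ v < n, f v < n) (hg : ∀ v < n, g v < k)
    (hw : (n + k + 2) ^ 2 ≤ 2 ^ w) (hi : i < n) {s : State} (hs : AtPoint f g n k i s)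
    (h : RanksUpTo f g n k i s.mem) :
    ∃ t s', Exec w countRanks s t s' ∧ t ≤ 50 ∧ AtPoint f g n k i s' ∧
      RanksUpTo f g n k (i + 1) s'.mem := by
  have hgi := hg i hi
  have hri := rank_le (f := f) (g := g) i
  set s₁ := s.setMem 4 i (rank f g i) with hs₁
  have hat₁ : AtPoint f g n k i s₁ := hs.setMem (by norm_num) _ _
  set s₂ := s₁.setMem 3 (f i * k + g i) (rank f g i + 1) with hs₂
  have hat₂ : AtPoint f g n k i s₂ := hat₁.setMem (by norm_num) _ _
  have hidx := eval_colorIdx hf hg hw hi hs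
  have hidx₁ := eval_colorIdx hf hg hw hi hat₁
  have hidx₂ := eval_levelIdx hf hw hi hat₂ (by simp [hs₂, hs₁, State.setMem])
  have hl : s₂.mem 5 (f i * n + rank f g i) =
      Nat.count (fun u => f u = f i ∧ rank f g u = rank f g i) i := by
    rw [← h.levels _ _ (by omega)]
    simp [hs₂, hs₁, State.setMem]
  have hl' : Nat.count (fun u => f u = f i ∧ rank f g u = rank f g i) i ≤ i := Nat.count_le _
  -- The counter, read before it is incremented, is the rank by definition.
  have hrank : s.mem 3 (f i * k + g i) = rank f g i := h.counts _ _ hgi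
  refine ⟨_, _, (exec_store (x := i) (by simp [Expr.eval, hs.reg2])
    (by rw [Expr.eval, hidx, hrank])).seq
    ((exec_incr (x := f i * k + g i) hidx₁ (by simpa [hs₁, State.setMem] using hrank)
    (small_lt hw (by omega))).seq (exec_incr hidx₂ hl (small_lt hw (by omega)))),
    ?_, hat₂.setMem (by norm_num) _ _, ⟨?_, ?_, ?_, ?_⟩⟩
  · norm_num [Expr.cost, colorIdx, levelIdx, cur]
  · intro x a ha
    have := h.counts x a ha
    have hmem : (s₂.setMem 5 (f i * n + rank f g i) (Nat.count
        (fun u => f u = f i ∧ rank f g u = rank f g i) i + 1)).mem 3 =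
        Function.update (s.mem 3) (f i * k + g i) (rank f g i + 1) := by
      simp [State.setMem, hs₂, hs₁]
    rw [hmem, Nat.count_succ, Function.update_apply]
    simp only [mul_add_inj ha hgi]
    by_cases hx : f i = x ∧ g i = a
    · obtain ⟨rfl, rfl⟩ := hx
      simp [rank]
    · have hx' : ¬ (x = f i ∧ a = g i) := fun h => hx ⟨h.1.symm, h.2.symm⟩
      simp [hx, hx', this]
  · intro v hv
    have hmem : (s₂.setMem 5 (f i * n + rank f g i) (Nat.count
        (fun u => f u = f i ∧ rank f g u = rank f g i) i + 1)).mem 4 =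
        Function.update (s.mem 4) i (rank f g i) := by
      simp [State.setMem, hs₂, hs₁]
    rw [hmem, Function.update_apply]
    split_ifs with hvi
    · rw [hvi]
    exact h.ranks v (by omega)
  · intro x r hr
    have := h.levels x r hr
    have hmem : (s₂.setMem 5 (f i * n + rank f g i) (Nat.count
        (fun u => f u = f i ∧ rank f g u = rank f g i) i + 1)).mem 5 =
        Function.update (s.mem 5) (f i * n + rank f g i) (Nat.count
          (fun u => f u = f i ∧ rank f g u = rank f g i) i + 1) := by
      simp [State.setMem, hs₂, hs₁]
    rw [hmem, Nat.count_succ, Function.update_apply]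
    simp only [mul_add_inj hr (show rank f g i < n by omega)]
    by_cases hx : f i = x ∧ rank f g i = r
    · obtain ⟨rfl, rfl⟩ := hx
      simp
    · have hx' : ¬ (x = f i ∧ r = rank f g i) := fun h => hx ⟨h.1.symm, h.2.symm⟩
      simp [hx, hx', this]
  · intro a
    simpa [State.setMem, hs₂, hs₁] using h.surplus a

/-- Between the two halves of `computeKeys`, the keys are one point ahead of the representatives, so
no `KeysUpTo` describes the memory and the arrays are listed one by one. -/
theorem exists_exec_storeKey {w i : ℕ} (hf : ∀ v < n, f v < n)
    (hw : (n + k + 2) ^ 2 ≤ 2 ^ w) (hi : i < n) {s : State} (hs : AtPoint f g n k i s)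
    (h : KeysUpTo f g n k i s.mem) :
    ∃ t s', Exec w (.cond (.op .eq (.load 5 levelIdx) (.reg 1))
      (.store 7 (.reg 2) (cur 0))
      (.seq (.store 7 (.reg 2) (.op .add (.reg 0) (.load 6 (cur 1)))) (incr 6 (cur 1)))) s t s' ∧
      t ≤ 40 ∧ AtPoint f g n k i s' ∧ s'.mem 4 = s.mem 4 ∧ s'.mem 5 = s.mem 5 ∧
      (∀ a, s'.mem 6 a = Nat.count (fun u => ¬ IsBalanced f g n k u ∧ g u = a) (i + 1)) ∧
      s'.mem 7 = Function.update (s.mem 7) i (key f g n k i) ∧ s'.mem 8 = s.mem 8 := by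
  have hri := rank_le (f := f) (g := g) i
  have hsi := surplusRank_le (f := f) (g := g) (n := n) (k := k) i
  have hidx := eval_levelIdx hf hw hi hs (h.ranks i hi)
  have hlev := h.levels (f i) (rank f g i) (by omega)
  have hc : (Expr.op .eq (.load 5 levelIdx) (.reg 1)).eval w s =
      if IsBalanced f g n k i then 1 else 0 := by
    simp only [Expr.eval, hidx, hlev, BinOp.eval, hs.reg1]
    rfl
  by_cases hb : IsBalanced f g n k i
  · refine ⟨_, _, .cond_true (by simp [hc, hb]) (exec_store (x := i) (y := key f g n k i)
      (by simp [Expr.eval, hs.reg2]) (by simp [eval_cur w 0 hs, hs.mem0 i hi, key, hb])),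
      ?_, hs.setMem (by norm_num) _ _, ?_, ?_, ?_, ?_, ?_⟩
    · norm_num [Expr.cost, levelIdx, cur]
    · simp [State.setMem]
    · simp [State.setMem]
    · intro a
      simp [State.setMem, Nat.count_succ, hb, h.surplus]
    · simp [State.setMem]
    · simp [State.setMem]
  · have h6 : s.mem 6 (g i) = surplusRank f g n k i := h.surplus _
    have hat : AtPoint f g n k i (s.setMem 7 i (key f g n k i)) := hs.setMem (by norm_num) _ _
    refine ⟨_, _, .cond_false (by simp [hc, hb]) ((exec_store (x := i) (y := key f g n k i)
      (by simp [Expr.eval, hs.reg2]) ?_).seq (exec_incr (x := g i)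
      (y := surplusRank f g n k i) ?_ ?_ (small_lt hw (by omega)))),
      ?_, hat.setMem (by norm_num) _ _, ?_, ?_, ?_, ?_, ?_⟩
    · simp only [Expr.eval, eval_cur w 1 hs, hs.mem1 i hi, hs.reg0, h6, key, hb, if_false]
      exact add_eval_of_lt (small_lt hw (by omega))
    · rw [eval_cur w 1 hat, hat.mem1 i hi]
    · simpa [State.setMem] using h6
    · norm_num [Expr.cost, levelIdx, cur]
    · simp [State.setMem]
    · simp [State.setMem]
    · intro a
      by_cases ha : a = g i
      · subst ha
        simp [State.setMem, Nat.count_succ, hb, surplusRank]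
      · simp [State.setMem, Nat.count_succ, ha, Ne.symm ha, h.surplus]
    · simp [State.setMem]
    · simp [State.setMem]

theorem exists_exec_computeKeys {w i : ℕ} (hf : ∀ v < n, f v < n)
    (hw : (n + k + 2) ^ 2 ≤ 2 ^ w) (hi : i < n) {s : State} (hs : AtPoint f g n k i s)
    (h : KeysUpTo f g n k i s.mem) :
    ∃ t s', Exec w computeKeys s t s' ∧ t ≤ 50 ∧ AtPoint f g n k i s' ∧
      KeysUpTo f g n k (i + 1) s'.mem := by
  obtain ⟨t, s', he, ht, hat, h4, h5, h6, h7, h8⟩ := exists_exec_storeKey hf hw hi hs h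
  refine ⟨_, _, he.seq (exec_store (x := key f g n k i) (y := i)
    (by simp [eval_cur w 7 hat, h7]) (by simp [Expr.eval, hat.reg2])), ?_,
    hat.setMem (by norm_num) _ _, ⟨?_, ?_, ?_, ?_, ?_⟩⟩
  · norm_num [Expr.cost, cur]
    omega
  · simpa [State.setMem, h4] using h.ranks
  · simpa [State.setMem, h5] using h.levels
  · simpa [State.setMem] using h6
  · intro v hv
    have hmem : (s'.setMem 8 (key f g n k i) i).mem 7 =
        Function.update (s.mem 7) i (key f g n k i) := by simp [State.setMem, h7]
    rw [hmem, Function.update_apply]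
    split_ifs with hvi
    · rw [hvi]
    · exact h.keys v (by omega)
  · intro v hv
    -- The point `i` becomes the representative of its key; other keys keep theirs.
    simp only [State.setMem, h8, Function.update_self, Function.update_apply]
    split_ifs with hvi
    · exact ⟨by omega, hvi.symm⟩
    · have hne : v ≠ i := fun h => hvi (by rw [h])
      have := h.reps v (by omega)
      exact ⟨by omega, this.2⟩

theorem exists_exec_writeOutput {w i : ℕ} (hi : i < n) {s : State} (hs : AtPoint f g n k i s)
    (h : OutputUpTo f g n k i s.mem) :
    ∃ t s', Exec w writeOutput s t s' ∧ t ≤ 50 ∧ AtPoint f g n k i s' ∧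
      OutputUpTo f g n k (i + 1) s'.mem := by
  refine ⟨_, _, exec_store (x := i) (y := s.mem 8 (key f g n k i))
    (by simp [Expr.eval, hs.reg2]) (by simp [Expr.eval, eval_cur w 7 hs, h.keys i hi]), ?_,
    hs.setMem le_rfl _ _, ⟨?_, ?_, ?_⟩⟩
  · norm_num [Expr.cost, cur]
  · simpa [State.setMem] using h.keys
  · simpa [State.setMem] using h.reps
  · intro v hv
    have hmem : (s.setMem 2 i (s.mem 8 (key f g n k i))).mem 2 =
        Function.update (s.mem 2) i (s.mem 8 (key f g n k i)) := by simp [State.setMem]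
    have hmem' : (s.setMem 2 i (s.mem 8 (key f g n k i))).mem 8 = s.mem 8 := by
      simp [State.setMem]
    rw [hmem, hmem', Function.update_apply]
    split_ifs with hvi
    · rw [hvi]
    · exact h.output v (by omega)

theorem exec_assign_zero (w : ℕ) (s : State) :
    Exec w (.assign 2 (.const 0)) s 2 (s.setReg 2 0) := by
  have := Exec.assign (w := w) 2 (.const 0) s
  rwa [const_eval_of_lt (by positivity)] at this

/-- Keys may be `n` or larger and hence are no valid cluster numbers. The output is therefore a
representative, which is below `n` and determines the key because it carries it. -/
theorem exists_exec_program {w : ℕ} (hf : ∀ v < n, f v < n) (hg : ∀ v < n, g v < k)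
    (hw : (n + k + 2) ^ 2 ≤ 2 ^ w) {s : State} (hs : AtPoint f g n k 0 s)
    (hmem : ∀ a, 2 ≤ a → ∀ x, s.mem a x = 0) :
    ∃ t s', Exec w program s t s' ∧ t ≤ 200 * n + 20 ∧
      (∀ v < n, s'.mem 2 v < n) ∧
      ∀ u < n, ∀ v < n, s'.mem 2 u = s'.mem 2 v ↔ key f g n k u = key f g n k v := by
  have hn : n + 1 < 2 ^ w := small_lt hw (by omega)
  obtain ⟨t₁, s₁, e₁, ht₁, hs₁, h₁⟩ := exists_exec_forPoints hn (Inv := RanksUpTo f g n k)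
    (fun i hi s hs h => exists_exec_countRanks hf hg hw hi hs h) hs
    ⟨by simp [hmem], by simp, by simp [hmem], by simp [hmem]⟩
  obtain ⟨t₂, s₂, e₂, ht₂, hs₂, h₂⟩ := exists_exec_forPoints hn (Inv := KeysUpTo f g n k)
    (fun i hi s hs h => exists_exec_computeKeys hf hw hi hs h) (hs₁.goto 0)
    ⟨h₁.ranks, h₁.levels, by simpa [State.setReg] using h₁.surplus, by simp, by simp⟩
  obtain ⟨t₃, s₃, e₃, ht₃, hs₃, h₃⟩ := exists_exec_forPoints hn (Inv := OutputUpTo f g n k)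
    (fun i hi s hs h => exists_exec_writeOutput hi hs h) (hs₂.goto 0)
    ⟨h₂.keys, h₂.reps, by simp⟩
  refine ⟨_, s₃, e₁.seq ((exec_assign_zero w s₁).seq (e₂.seq ((exec_assign_zero w s₂).seq e₃))),
    by omega, fun v hv => ?_, fun u hu v hv => ?_⟩
  · rw [h₃.output v hv]
    exact (h₃.reps v hv).1
  · rw [h₃.output u hu, h₃.output v hv]
    refine ⟨fun h => ?_, fun h => by rw [h]⟩
    rw [← (h₃.reps u hu).2, h, (h₃.reps v hv).2]

end FairClustering

namespace FairClustering

open Finset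

/-! ### Transfer to clusterings of `Fin n` -/

theorem card_filter_fin {n : ℕ} (p : ℕ → Prop) [DecidablePred p] :
    #{v : Fin n | p v} = #{v ∈ range n | p v} := by
  rw [← card_map Fin.valEmbedding]
  congr 1
  ext v
  simp only [mem_map, mem_filter, mem_univ, true_and, Fin.valEmbedding_apply, mem_range]
  exact ⟨fun ⟨u, hu, h⟩ => h ▸ ⟨u.2, hu⟩, fun h => ⟨⟨v, h.1⟩, h.2, rfl⟩⟩

/-- The clustering into the fibres of `q`. -/
def fiberClustering {V ι : Type*} [Fintype V] [DecidableEq V] [DecidableEq ι] (q : V → ι) :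
    Clustering V :=
  Finpartition.ofSetoid (Setoid.ker q)

theorem together_fiberClustering {V ι : Type*} [Fintype V] [DecidableEq V] [DecidableEq ι]
    (q : V → ι) (u v : V) : (fiberClustering q).Together u v ↔ q u = q v := by
  rw [← part_eq_part_iff_together, ← mem_part_iff_part_eq, fiberClustering,
    Finpartition.mem_part_ofSetoid_iff_rel, Setoid.ker_def]

theorem isFair_fiberClustering {V ι χ : Type*} [Fintype V] [DecidableEq V] [DecidableEq ι]
    [DecidableEq χ] {σ : V → χ} (hσ : ∀ a b, colorCount σ univ a = colorCount σ univ b) {q : V → ι}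
    (h : ∀ u a b, #{v | q v = q u ∧ σ v = a} = #{v | q v = q u ∧ σ v = b}) :
    (fiberClustering q).IsFair σ := by
  intro K hK a b
  obtain ⟨u, hu⟩ := (fiberClustering q).nonempty_of_mem_parts hK
  have hKu : K = ({v | q v = q u} : Finset V) := by
    rw [← (fiberClustering q).part_eq_of_mem hK hu]
    ext v
    rw [mem_part_iff_part_eq, part_eq_part_iff_together, together_fiberClustering]
    simp [eq_comm]
  have := h u a b
  rw [hσ b a, hKu]
  simp only [colorCount, filter_filter, this]

/-- The algorithm computes a fair clustering that is a `4 (k - 1)`-approximation, in linear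
time. -/
theorem exists_exec_program_isFair {n k : ℕ} {σ : Fin n → Fin k}
    (hσ : ∀ a b, colorCount σ univ a = colorCount σ univ b) {D : Clustering (Fin n)} {f : ℕ → ℕ}
    (hD : Encodes f D) {w : ℕ} (hw : (n + k + 2) ^ 2 ≤ 2 ^ w) :
    ∃ (t : ℕ) (s : WordRAM.State) (F : Clustering (Fin n)),
      WordRAM.Exec w program (inputState σ f) t s ∧ Encodes (s.mem 2) F ∧ t ≤ 200 * n + 20 ∧
      F.IsFair σ ∧ ∀ N : Clustering (Fin n), N.IsFair σ →
        D.dist F ≤ 4 * (k - 1) * D.dist N := by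
  -- The value `0` beyond `n` is harmless: only points below `n` are counted.
  set g : ℕ → ℕ := fun v => if h : v < n then σ ⟨v, h⟩ else 0 with hgdef
  have hgσ : ∀ v : Fin n, g v = σ v := fun v => by simp [hgdef]
  have hgσ' : ∀ (v : Fin n) (a : Fin k), σ v = a ↔ g v = a := fun v a => by
    rw [hgσ, Fin.ext_iff]
  have hf : ∀ v < n, f v < n := fun v hv => hD.1 ⟨v, hv⟩
  have hg : ∀ v < n, g v < k := fun v hv => by
    rw [hgσ ⟨v, hv⟩]
    exact (σ ⟨v, hv⟩).2
  have hcol : ∀ a < k, ∀ b < k, #{v ∈ range n | g v = a} = #{v ∈ range n | g v = b} := by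
    intro a ha b hb
    have := hσ ⟨a, ha⟩ ⟨b, hb⟩
    simp only [colorCount, hgσ'] at this
    rwa [card_filter_fin (fun v => g v = a), card_filter_fin (fun v => g v = b)] at this
  obtain ⟨t, s, he, ht, hlt, hs⟩ := exists_exec_program (s := inputState σ f) hf hg hw
    ⟨rfl, rfl, rfl, fun v hv => by simp [inputState, hv],
      fun v hv => by simp [inputState, hgdef, hv]⟩
    (fun a ha x => by
      have h0 : a ≠ 0 := by omega
      have h1 : a ≠ 1 := by omega
      simp [inputState, h0, h1])
  set q : Fin n → ℕ := fun v => key f g n k v with hq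
  refine ⟨t, s, fiberClustering q, he, ⟨fun v => hlt v v.2, fun u v => ?_⟩, ht,
    isFair_fiberClustering hσ fun u a b => ?_, fun N hN => ?_⟩
  · rw [together_fiberClustering]
    exact hs u u.2 v v.2
  · simp only [hgσ', hq]
    rw [card_filter_fin (fun v => key f g n k v = key f g n k u ∧ g v = a),
      card_filter_fin (fun v => key f g n k v = key f g n k u ∧ g v = b)]
    exact card_key_eq hf hg hcol _ a.2 b.2
  · have hmain := sum_card_le hσ hN (p := fun v : Fin n => f v) (q := q)
      (bal := fun v => IsBalanced f g n k v) ?_ ?_ ?_ ?_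
    · rw [← two_mul_dist hD.2 (fun u v => (together_fiberClustering q u v).symm),
        ← two_mul_dist hD.2 (part_eq_part_iff_together N), Fintype.card_fin] at hmain
      linarith
    · intro u
      obtain ⟨b, hb, h⟩ := exists_card_surplus_add_le (f := f) hg (Nat.zero_lt_of_lt (σ u).2) (f u)
      refine ⟨⟨b, hb⟩, fun a => ?_⟩
      have := h a a.2
      simp only [colorCount, filter_filter, hgσ', eq_comm (a := f u), and_assoc]
      rwa [card_filter_fin (fun v => f v = f u ∧ ¬ IsBalanced f g n k v ∧ g v = a),
        card_filter_fin (fun v => f v = f u ∧ g v = b),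
        card_filter_fin (fun v => f v = f u ∧ g v = a)]
    · intro u v hu hv
      simp [hq, key, hu, hv]
    · intro u v hu hv
      have := hf u u.2
      simp only [hq, key, hu, hv, if_true, if_false]
      omega
    · intro u hu
      simp only [hq, eq_comm (a := key f g n k u), Fintype.card_fin]
      rw [card_filter_fin (fun v => key f g n k v = key f g n k u)]
      exact card_key_le hf hg hu

end FairClustering

theorem mainTheorem1 :
    ∃ (P : WordRAM.Prog) (c : ℕ) (T A B : ℝ),
      ∀ (n k : ℕ) (σ : Fin n → Fin k),
        (∀ a b : Fin k, colorCount σ Finset.univ a = colorCount σ Finset.univ b) →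
      ∀ (D : Clustering (Fin n)) (f : ℕ → ℕ), Encodes f D →
      ∀ w : ℕ, (n + k + 2) ^ c ≤ 2 ^ w →
        ∃ (t : ℕ) (s : WordRAM.State) (F : Clustering (Fin n)),
          WordRAM.Exec w P (inputState σ f) t s ∧
          Encodes (s.mem 2) F ∧
          (2 ≤ n → (t : ℝ) ≤ T * ((n : ℝ) * Real.logb 2 n)) ∧
          Clustering.IsCloseFair σ
            (A * ((k : ℝ) ^ (1.6 : ℝ) * Real.logb 2 k ^ (2.81 : ℝ))) D F ∧
          ((∃ j : ℕ, k = 2 ^ j) →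
            Clustering.IsCloseFair σ (B * (k : ℝ) ^ (1.6 : ℝ)) D F) := by
  -- `220` absorbs `200 * n + 20`, as `n` and `Real.logb 2 n` are at least `1` when `n ≥ 2`; both
  -- `4`s come from `4 * (k - 1)`.
  refine ⟨FairClustering.program, 2, 220, 4, 4, fun n k σ hσ D f hD w hw => ?_⟩
  obtain ⟨t, s, F, he, hF, ht, hfair, hdist⟩ :=
    FairClustering.exists_exec_program_isFair hσ hD hw
  have hpow : 1 ≤ k → (k : ℝ) ≤ (k : ℝ) ^ (1.6 : ℝ) := fun hk =>
    Real.self_le_rpow_of_one_le (by exact_mod_cast hk) (by norm_num)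
  have hB : ((4 * (k - 1) : ℕ) : ℝ) ≤ 4 * (k : ℝ) ^ (1.6 : ℝ) := by
    rcases Nat.eq_zero_or_pos k with rfl | hk
    · simp
      positivity
    · have := hpow hk
      push_cast [Nat.cast_sub hk]
      linarith
  have hA : ((4 * (k - 1) : ℕ) : ℝ) ≤
      4 * ((k : ℝ) ^ (1.6 : ℝ) * Real.logb 2 k ^ (2.81 : ℝ)) := by
    rcases lt_or_ge k 2 with hk | hk
    -- For `k = 1` the logarithm makes the allowed factor `0`, so `k - 1` rather than `k` is
    -- essential; for `k = 0` the truncated `k - 1` is `0`.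
    · interval_cases k <;> simp <;> positivity
    · have hk' : (2 : ℝ) ≤ k := by exact_mod_cast hk
      have hlog : 1 ≤ Real.logb 2 k := by
        rwa [Real.le_logb_iff_rpow_le one_lt_two (by linarith), Real.rpow_one]
      have := Real.one_le_rpow hlog (show (0 : ℝ) ≤ 2.81 by norm_num)
      refine hB.trans (mul_le_mul_of_nonneg_left ?_ (by norm_num))
      exact le_mul_of_one_le_right (by positivity) this
  have hclose : ∀ γ : ℝ, ((4 * (k - 1) : ℕ) : ℝ) ≤ γ → Clustering.IsCloseFair σ γ D F := by
    refine fun γ hγ => ⟨hfair, fun N hN => ?_⟩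
    calc (D.dist F : ℝ) ≤ ((4 * (k - 1) * D.dist N : ℕ) : ℝ) := by exact_mod_cast hdist N hN.1
      _ = ((4 * (k - 1) : ℕ) : ℝ) * D.dist N := by push_cast; ring
      _ ≤ γ * D.dist N := by gcongr
  refine ⟨t, s, F, he, hF, fun hn => ?_, hclose _ hA, fun _ => hclose _ hB⟩
  have hn' : (2 : ℝ) ≤ n := by exact_mod_cast hn
  have hlog : 1 ≤ Real.logb 2 n := by
    rwa [Real.le_logb_iff_rpow_le one_lt_two (by linarith), Real.rpow_one]
  have ht' : (t : ℝ) ≤ 200 * n + 20 := by exact_mod_cast ht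
  nlinarith
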